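/- Let $f:\mathbb{R}^m\to\mathbb{R}\cup\{+\infty\}$ be proper and lower semicontinuous, and let $g:\mathbb{R}^m\to\mathbb{R}$ be differentiable with $L_g$-Lipschitz continuous gradient, $L_g\ge 0$. Let $(\alpha_n)_{n\in\mathbb N},(\beta_n)_{n\in\mathbb N}$ be real sequences with $\alpha_n\to\alpha$, $\beta_n\to\beta\in\mathbb{R}$, let $s>0$, let $x_{-1}=x_0\in\mathbb{R}^m$, and let $(x_n)_{n\in\mathbb N},(y_n)_{n\in\mathbb N},(z_n)_{n\in\mathbb N}$ satisfy, for all $n\in\mathbb{N}=\{0,1,2,\dots\}$, $$y_n=x_n+\alpha_n(x_n-x_{n-1}),\qquad z_n=x_n+\beta_n(x_n-x_{n-1}),$$ and one of the following (where the upper bound on $s$ is read as $+\infty$ if $L_g=0$): * (PADISNO) $f$ is bounded from below, $\alpha\in(-\tfrac12,\tfrac12)$, $0<s<\frac{1-2|\alpha|}{L_g(2|\beta|+1)}$, and for all $n\in\mathbb N$ $$x_{n+1}\in\operatorname*{argmin}_{y\in\mathbb{R}^m}\Big\{f(y)+\langle\nabla g(z_n),y-y_n\rangle+\frac1{2s}\|y-y_n\|^2\Big\};$$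 * (c-PADISNO) $f$ is convex, $\alpha\in(-1,1)$, $0<s<\frac{2(1-|\alpha|)}{L_g(2|\beta|+1)}$, and for all $n\in\mathbb N$ $$x_{n+1}=\operatorname{prox}_{sf}(y_n-s\nabla g(z_n))=\operatorname*{argmin}_{y\in\mathbb{R}^m}\Big\{f(y)+\frac1{2s}\|y-(y_n-s\nabla g(z_n))\|^2\Big\}.$$ Assume that $f+g$ is strongly convex. Then $f+g$ has a unique minimizer $x^*$, and there exist $Q\in[0,1)$, $a_1>0$ and $\overline N\in\mathbb{N}$ such that for every $n\ge\overline N$: (i) $(f+g)(x_n)-(f+g)(x^*)\le a_1Q^n$; (ii) $\|x_n-x^*\|\le a_1Q^{n/2}$, $\|y_n-x^*\|\le a_1Q^{n/2}$ and $\|z_n-x^*\|\le a_1Q^{n/2}$. -/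

import Mathlib

open Filter Topology
open scoped Gradient NNReal

noncomputable section

/-- The effective domain of an extended-real-valued function. -/
def effDom {m : ℕ} (f : EuclideanSpace ℝ (Fin m) → EReal) : Set (EuclideanSpace ℝ (Fin m)) :=
  {x | f x < ⊤}

/-- `f` takes values in `ℝ ∪ {+∞}` and is not identically `+∞`. -/
def IsProperFun {m : ℕ} (f : EuclideanSpace ℝ (Fin m) → EReal) : Prop :=
  (∀ x, f x ≠ ⊥) ∧ (effDom f).Nonempty

/-- Convexity of a function with values in `ℝ ∪ {+∞}`: the domain is convex and the (real-valued)
restriction to the domain is convex. -/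
def IsConvexFun {m : ℕ} (f : EuclideanSpace ℝ (Fin m) → EReal) : Prop :=
  ConvexOn ℝ (effDom f) (fun x => (f x).toReal)

/-- Strong convexity (with some modulus `μ > 0`) of a function with values in `ℝ ∪ {+∞}`. -/
def IsStronglyConvexFun {m : ℕ} (f : EuclideanSpace ℝ (Fin m) → EReal) : Prop :=
  ∃ μ : ℝ, 0 < μ ∧ StrongConvexOn (effDom f) μ (fun x => (f x).toReal)

/-- The set of global minimizers. -/
def argminSet {m : ℕ} (F : EuclideanSpace ℝ (Fin m) → EReal) : Set (EuclideanSpace ℝ (Fin m)) :=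
  {p | ∀ q, F p ≤ F q}

/-- The objective function `f + g`. -/
def objective {m : ℕ} (f : EuclideanSpace ℝ (Fin m) → EReal) (g : EuclideanSpace ℝ (Fin m) → ℝ) :
    EuclideanSpace ℝ (Fin m) → EReal :=
  fun x => f x + (g x : EReal)

/-- `p = prox_{s f}(v)`, i.e. `p` minimizes `q ↦ f q + ‖q - v‖² / (2 s)`; for proper, convex, lower
semicontinuous `f` and `s > 0` there is exactly one such `p`. -/
def IsProx {m : ℕ} (s : ℝ) (f : EuclideanSpace ℝ (Fin m) → EReal)
    (v p : EuclideanSpace ℝ (Fin m)) : Prop :=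
  p ∈ argminSet (fun q => f q + ((1 / (2 * s) * ‖q - v‖ ^ 2 : ℝ) : EReal))

/-- The standing assumptions: `f` is proper and lower semicontinuous, `g` is differentiable with
`L`-Lipschitz gradient. -/
structure ProblemSetting {m : ℕ} (f : EuclideanSpace ℝ (Fin m) → EReal)
    (g : EuclideanSpace ℝ (Fin m) → ℝ) (L : ℝ≥0) : Prop where
  proper : IsProperFun f
  lsc : LowerSemicontinuous f
  diff : Differentiable ℝ g
  lipschitz : LipschitzWith L (∇ g)

/-- The extrapolation steps. Since subtraction on `ℕ` is truncated, `x (0 - 1) = x 0`, which is the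
convention `x_{-1} = x_0`. -/
structure Extrapolation {m : ℕ} (α β : ℕ → ℝ) (x y z : ℕ → EuclideanSpace ℝ (Fin m)) : Prop where
  y_eq : ∀ n, y n = x n + α n • (x n - x (n - 1))
  z_eq : ∀ n, z n = x n + β n • (x n - x (n - 1))

/-- `x, y, z` are generated by PADISNO with inertial parameters `α n → a`, `β n → b` and step
size `s`. The bound `s < (1 - 2|a|) / (L (2|b| + 1))` is written without division, so that for
`L = 0` it puts no upper bound on `s`. -/
structure IsPADISNO {m : ℕ} (f : EuclideanSpace ℝ (Fin m) → EReal)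
    (g : EuclideanSpace ℝ (Fin m) → ℝ) (L : ℝ≥0) (α β : ℕ → ℝ) (a b s : ℝ)
    (x y z : ℕ → EuclideanSpace ℝ (Fin m)) : Prop where
  bddBelow : ∃ c : ℝ, ∀ q, (c : EReal) ≤ f q
  α_lim : Tendsto α atTop (𝓝 a)
  a_mem : a ∈ Set.Ioo (-(1 / 2) : ℝ) (1 / 2)
  β_lim : Tendsto β atTop (𝓝 b)
  s_pos : 0 < s
  s_lt : s * ((L : ℝ) * (2 * |b| + 1)) < 1 - 2 * |a|
  extrapolation : Extrapolation α β x y z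
  step : ∀ n, x (n + 1) ∈ argminSet (fun q =>
    f q + ((inner ℝ (∇ g (z n)) (q - y n) + 1 / (2 * s) * ‖q - y n‖ ^ 2 : ℝ) : EReal))

/-- `x, y, z` are generated by c-PADISNO (`f` convex) with inertial parameters `α n → a`,
`β n → b` and step size `s`. The bound `s < 2 (1 - |a|) / (L (2|b| + 1))` is written without
division, so that for `L = 0` it puts no upper bound on `s`. -/
structure IsCPADISNO {m : ℕ} (f : EuclideanSpace ℝ (Fin m) → EReal)
    (g : EuclideanSpace ℝ (Fin m) → ℝ) (L : ℝ≥0) (α β : ℕ → ℝ) (a b s : ℝ)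
    (x y z : ℕ → EuclideanSpace ℝ (Fin m)) : Prop where
  convex : IsConvexFun f
  α_lim : Tendsto α atTop (𝓝 a)
  a_mem : a ∈ Set.Ioo (-1 : ℝ) 1
  β_lim : Tendsto β atTop (𝓝 b)
  s_pos : 0 < s
  s_lt : s * ((L : ℝ) * (2 * |b| + 1)) < 2 * (1 - |a|)
  extrapolation : Extrapolation α β x y z
  step : ∀ n, IsProx s f (y n - s • ∇ g (z n)) (x (n + 1))

end

/-! Write `r n` for the gap of `f + g` at `x n` and `δ n` for `‖x n - x (n - 1)‖`. Comparing the
model minimizer with `x n` and applying the descent lemma to `g` gives `r (n + 1) ≤ r n - A δ (n +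
1)² + C n δ n δ (n + 1)`, where `A = κ / (2 s) - L / 2` and `C n → c₀ = |a| / s + L |b|`. Here `κ =
1` in general and `κ = 2` for convex `f`; the bound on `s` says exactly `c₀ < A`.

Strong convexity of `f + g`, with first-order optimality of the step tested at the minimizer, gives
the error bound `r (n + 1) ≤ K (δ n + δ (n + 1))²` for large `n`. Together these make `r n + (A / 2)
δ n²` contract geometrically (`linear_rate_of_sufficient_decrease`). Quadratic growth then turns
decay of `r` into decay of `‖x n - xstar‖`, and decay of `δ` carries this over to `y n` and `z n`.
-/

/-! ### Descent and first-order optimality -/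

/-- The descent lemma: a function whose gradient is `L`-Lipschitz lies below its quadratic upper
models. -/
theorem le_quadratic_of_lipschitz_gradient {E : Type*} [NormedAddCommGroup E]
    [InnerProductSpace ℝ E] [CompleteSpace E] {g : E → ℝ} {G : E → E} {L : ℝ}
    (hG : ∀ x, HasGradientAt g (G x) x) (hL : ∀ x y, ‖G x - G y‖ ≤ L * ‖x - y‖) (x v : E) :
    g (x + v) ≤ g x + inner ℝ (G x) v + L / 2 * ‖v‖ ^ 2 := by
  set ψ : ℝ → ℝ := fun t => g (x + t • v) - t * inner ℝ (G x) v - L / 2 * ‖v‖ ^ 2 * t ^ 2 with hψ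
  have hd : ∀ t, HasDerivAt ψ
      (inner ℝ (G (x + t • v)) v - inner ℝ (G x) v - L * ‖v‖ ^ 2 * t) t := by
    intro t
    have h1 : HasDerivAt (fun t : ℝ => x + t • v) v t := by
      simpa using ((hasDerivAt_id t).smul_const v).const_add x
    have h2 := (hG (x + t • v)).hasFDerivAt.comp_hasDerivAt t h1
    have h3 := (h2.sub ((hasDerivAt_id t).mul_const (inner ℝ (G x) v))).sub
      (((hasDerivAt_id t).pow 2).const_mul (L / 2 * ‖v‖ ^ 2))
    refine h3.congr_deriv ?_
    simp
    ring
  have hanti : AntitoneOn ψ (Set.Ici 0) := by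
    refine antitoneOn_of_deriv_nonpos (convex_Ici 0)
      (fun t _ => (hd t).continuousAt.continuousWithinAt)
      (fun t _ => (hd t).differentiableAt.differentiableWithinAt) fun t ht => ?_
    rw [interior_Ici, Set.mem_Ioi] at ht
    rw [(hd t).deriv, ← inner_sub_left]
    have h1 := real_inner_le_norm (G (x + t • v) - G x) v
    have h2 := hL (x + t • v) x
    rw [add_sub_cancel_left, norm_smul, Real.norm_of_nonneg ht.le] at h2
    nlinarith [mul_le_mul_of_nonneg_right h2 (norm_nonneg v)]
  have h := hanti (Set.mem_Ici.2 le_rfl) (Set.mem_Ici.2 zero_le_one) zero_le_one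
  simp only [hψ, one_smul, zero_smul, add_zero] at h
  linarith

theorem le_of_forall_le_add_mul {X Y c : ℝ} (h : ∀ t ∈ Set.Ioo (0 : ℝ) 1, X ≤ Y + t * c) :
    X ≤ Y := by
  have hlim : Tendsto (fun t : ℝ => Y + t * c) (𝓝[>] 0) (𝓝 Y) := by
    have : Continuous fun t : ℝ => Y + t * c := by fun_prop
    simpa using (this.tendsto 0).mono_left nhdsWithin_le_nhds
  refine ge_of_tendsto hlim ?_
  filter_upwards [Ioo_mem_nhdsGT zero_lt_one] with t ht using h t ht

/-- First-order optimality at a minimizer `p` of the model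
`(H - g) + ⟪c, · - y⟫ + ‖· - y‖² / (2 s)`, where `H` is strongly convex and `g` is smooth. -/
theorem le_of_isMinOn_proximal_model {E : Type*} [NormedAddCommGroup E]
    [InnerProductSpace ℝ E] [CompleteSpace E] {g H : E → ℝ} {G : E → E} {L μ s : ℝ} {D : Set E}
    (hG : ∀ x, HasGradientAt g (G x) x) (hL : ∀ x y, ‖G x - G y‖ ≤ L * ‖x - y‖)
    (hH : StrongConvexOn D μ H) {p y c : E} (hp : p ∈ D)
    (hmin : ∀ q ∈ D, H p - g p + (inner ℝ c (p - y) + 1 / (2 * s) * ‖p - y‖ ^ 2) ≤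
      H q - g q + (inner ℝ c (q - y) + 1 / (2 * s) * ‖q - y‖ ^ 2)) {u : E} (hu : u ∈ D) :
    H p + μ / 2 * ‖u - p‖ ^ 2 ≤
      H u + inner ℝ (c - G p) (u - p) + 1 / s * inner ℝ (p - y) (u - p) := by
  -- Test minimality at `p + t • (u - p)`, divide by `t`, let `t → 0`. The error collects the `t²`
  -- terms: `L / 2` from `-g`, `1 / (2 * s)` from the proximal square, `μ / 2` from the strong
  -- convexity term `t (1 - t)`.
  refine le_of_forall_le_add_mul (c := (L / 2 + 1 / (2 * s) + μ / 2) * ‖u - p‖ ^ 2) fun t ht => ?_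
  obtain ⟨ht0, ht1⟩ := ht
  set e := u - p with he
  have hq : (1 - t) • p + t • u = p + t • e := by rw [he]; module
  have hqD : p + t • e ∈ D := by
    rw [← hq]; exact hH.1 hp hu (by linarith) ht0.le (by ring)
  have hconv := hH.2 hp hu (by linarith : 0 ≤ 1 - t) ht0.le (by ring)
  rw [hq, norm_sub_rev, ← he] at hconv
  simp only [smul_eq_mul] at hconv
  have hm := hmin _ hqD
  -- `H - g` need not be convex, but `-g` also has an `L`-Lipschitz gradient, so it costs only
  -- `O(t²)`.
  have hneg := le_quadratic_of_lipschitz_gradient (g := fun x => -g x) (G := fun x => -G x) (L := L)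
    (fun x => by
      rw [hasGradientAt_iff_hasFDerivAt, map_neg]
      exact (hG x).hasFDerivAt.neg)
    (fun x y => by rw [neg_sub_neg, norm_sub_rev]; exact hL x y) p (t • e)
  have hexp : p + t • e - y = (p - y) + t • e := by abel
  rw [hexp, inner_add_right, norm_add_sq_real, inner_smul_right, inner_smul_right, norm_smul,
    Real.norm_of_nonneg ht0.le] at hm
  simp only [inner_neg_left, inner_smul_right, norm_smul, Real.norm_of_nonneg ht0.le] at hneg
  rw [inner_sub_left]
  have hs : 1 / s = 2 * (1 / (2 * s)) := by
    rw [one_div, one_div, mul_inv]; ring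
  rw [hs]
  generalize 1 / (2 * s) = σ at *
  refine le_of_mul_le_mul_left ?_ ht0
  nlinarith

/-! ### Linear rate from decrease and error bound -/

/-- Linear decay of a sequence of gaps `r` and step lengths `δ` satisfying a sufficient decrease
condition with inertial term and an error bound. -/
theorem linear_rate_of_sufficient_decrease {r δ C : ℕ → ℝ} {A c₀ K : ℝ}
    (hr : ∀ n ≥ 1, 0 ≤ r n) (hC : Tendsto C atTop (𝓝 c₀)) (hc₀ : 0 ≤ c₀)
    (hA : c₀ < A) (hδ : ∀ n, 0 ≤ δ n) (hK : 0 ≤ K)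
    (hdec : ∀ n ≥ 1, r (n + 1) ≤ r n - A * δ (n + 1) ^ 2 + C n * (δ n * δ (n + 1)))
    (herr : ∀ᶠ n in atTop, r (n + 1) ≤ K * (δ n + δ (n + 1)) ^ 2) :
    ∃ Q ∈ Set.Ioo (0 : ℝ) 1, ∃ c : ℝ, 0 < c ∧ ∃ N : ℕ, ∀ n ≥ N,
      r n ≤ c * Q ^ n ∧ δ n ^ 2 ≤ c * Q ^ n := by
  -- Half of `A - c₀` absorbs the fluctuation of `C n`; with weight `D = A / 2` the Lyapunov
  -- function `V` then drops by at least `η (δ n² + δ (n + 1)²)`.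
  set η := (A - c₀) / 4 with hη
  have hη0 : 0 < η := by rw [hη]; linarith
  set D := A / 2 with hD
  have hD0 : 0 < D := by rw [hD]; linarith
  have hev : ∀ᶠ n in atTop, C n ≤ c₀ + 2 * η :=
    (hC.eventually (gt_mem_nhds (by linarith : c₀ < c₀ + 2 * η))).mono fun n h => h.le
  obtain ⟨N, hN⟩ := eventually_atTop.1 ((hev.and herr).and (eventually_ge_atTop 1))
  set V : ℕ → ℝ := fun n => r n + D * δ n ^ 2 with hV
  set M := (2 * K + D) / η with hM
  have hM0 : 0 < M := by rw [hM]; positivity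
  have hstep : ∀ n ≥ N, V (n + 1) ≤ M / (1 + M) * V n := by
    intro n hn
    obtain ⟨⟨h1, h2⟩, h3⟩ := hN n hn
    have h4 := hdec n h3
    have hprod : C n * (δ n * δ (n + 1)) ≤ (c₀ + 2 * η) * ((δ n ^ 2 + δ (n + 1) ^ 2) / 2) :=
      (mul_le_mul_of_nonneg_right h1 (mul_nonneg (hδ _) (hδ _))).trans
        (mul_le_mul_of_nonneg_left (by nlinarith [sq_nonneg (δ n - δ (n + 1))]) (by linarith))
    have hdiff : η * (δ n ^ 2 + δ (n + 1) ^ 2) ≤ V n - V (n + 1) := by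
      simp only [hV, hD]
      have : A = c₀ + 4 * η := by rw [hη]; ring
      rw [this] at h4 ⊢
      nlinarith
    have hVK : V (n + 1) ≤ (2 * K + D) * (δ n ^ 2 + δ (n + 1) ^ 2) := by
      simp only [hV]
      have : K * (δ n + δ (n + 1)) ^ 2 ≤ K * (2 * (δ n ^ 2 + δ (n + 1) ^ 2)) :=
        mul_le_mul_of_nonneg_left (by nlinarith [sq_nonneg (δ n - δ (n + 1))]) hK
      nlinarith [mul_nonneg hD0.le (sq_nonneg (δ n))]
    have hfin : V (n + 1) ≤ M * (V n - V (n + 1)) := by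
      calc V (n + 1) ≤ (2 * K + D) * (δ n ^ 2 + δ (n + 1) ^ 2) := hVK
        _ = M * (η * (δ n ^ 2 + δ (n + 1) ^ 2)) := by rw [hM]; field_simp
        _ ≤ _ := mul_le_mul_of_nonneg_left hdiff hM0.le
    rw [div_mul_eq_mul_div, le_div_iff₀ (by linarith)]
    linarith
  set Q := M / (1 + M) with hQ
  have hQ0 : 0 < Q := by rw [hQ]; positivity
  have hQ1 : Q < 1 := by rw [hQ, div_lt_one (by linarith)]; linarith
  have hVN : 0 ≤ V N := by
    have := hr N (hN N le_rfl).2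
    simp only [hV]; positivity
  have hgeo : ∀ n ≥ N, V n ≤ V N / Q ^ N * Q ^ n := by
    intro n hn
    induction n, hn using Nat.le_induction with
    | base => rw [div_mul_cancel₀ _ (by positivity)]
    | succ n hn ih =>
      calc V (n + 1) ≤ Q * V n := hstep n hn
        _ ≤ Q * (V N / Q ^ N * Q ^ n) := mul_le_mul_of_nonneg_left ih hQ0.le
        _ = _ := by ring
  have hc : 0 ≤ V N / Q ^ N := by positivity
  -- The `+ 1` keeps the constant positive when `V N = 0`; the factor `1 / D` serves the bound on `δ
  -- n ^ 2`.
  refine ⟨Q, ⟨hQ0, hQ1⟩, (V N / Q ^ N + 1) * (1 + 1 / D), by positivity, N, fun n hn => ?_⟩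
  have hn0 := hr n (hN n hn).2
  have hg := hgeo n hn
  have hQn : 0 < Q ^ n := by positivity
  have hg' : V n ≤ (V N / Q ^ N + 1) * Q ^ n := by linarith
  have hT : 0 ≤ (V N / Q ^ N + 1) * Q ^ n := by positivity
  have hsplit : (V N / Q ^ N + 1) * (1 + 1 / D) * Q ^ n =
    (V N / Q ^ N + 1) * Q ^ n + (V N / Q ^ N + 1) * Q ^ n / D := by ring
  rw [hsplit]
  have hT' := div_nonneg hT hD0.le
  simp only [hV] at hg'
  constructor
  · nlinarith [mul_nonneg hD0.le (sq_nonneg (δ n))]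
  · have : δ n ^ 2 ≤ (V N / Q ^ N + 1) * Q ^ n / D := by
      rw [le_div_iff₀ hD0]; nlinarith
    linarith

/-! ### Extended-valued functions and their minimizers -/

theorem effDom_objective {m : ℕ} (f : EuclideanSpace ℝ (Fin m) → EReal)
    (g : EuclideanSpace ℝ (Fin m) → ℝ) : effDom (objective f g) = effDom f := by
  ext q
  simp only [effDom, objective, Set.mem_ofPred_eq, lt_top_iff_ne_top]
  induction f q <;> simp [← EReal.coe_add]

theorem IsProperFun.coe_toReal {m : ℕ} {f : EuclideanSpace ℝ (Fin m) → EReal}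
    (hf : IsProperFun f) {q : EuclideanSpace ℝ (Fin m)} (hq : q ∈ effDom f) :
    (((f q).toReal : ℝ) : EReal) = f q :=
  EReal.coe_toReal (ne_of_lt hq) (hf.1 q)

theorem IsProperFun.objective {m : ℕ} {f : EuclideanSpace ℝ (Fin m) → EReal}
    (hf : IsProperFun f) (g : EuclideanSpace ℝ (Fin m) → ℝ) : IsProperFun (objective f g) := by
  refine ⟨fun q => ?_, by rw [effDom_objective]; exact hf.2⟩
  have := hf.1 q
  simp only [_root_.objective, ne_eq, EReal.add_eq_bot_iff, not_or]
  exact ⟨this, EReal.coe_ne_bot _⟩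

theorem IsProperFun.toReal_objective {m : ℕ} {f : EuclideanSpace ℝ (Fin m) → EReal}
    (hf : IsProperFun f) (g : EuclideanSpace ℝ (Fin m) → ℝ) {q : EuclideanSpace ℝ (Fin m)}
    (hq : q ∈ effDom f) : (_root_.objective f g q).toReal = (f q).toReal + g q := by
  rw [_root_.objective, ← hf.coe_toReal hq, ← EReal.coe_add, EReal.toReal_coe, EReal.toReal_coe]

theorem lowerSemicontinuous_objective {m : ℕ} {f : EuclideanSpace ℝ (Fin m) → EReal}
    {g : EuclideanSpace ℝ (Fin m) → ℝ} (hf : LowerSemicontinuous f) (hg : Continuous g) :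
    LowerSemicontinuous (objective f g) :=
  hf.add' (continuous_coe_real_ereal.comp hg).lowerSemicontinuous fun _ =>
    EReal.continuousAt_add (Or.inr (EReal.coe_ne_bot _)) (Or.inr (EReal.coe_ne_top _))

/-- A minimizer of a strongly convex function satisfies a quadratic growth condition. -/
theorem StrongConvexOn.quadratic_growth {E : Type*} [NormedAddCommGroup E] [NormedSpace ℝ E]
    {H : E → ℝ} {D : Set E} {μ : ℝ} (hH : StrongConvexOn D μ H) {p u : E} (hp : p ∈ D)
    (hmin : ∀ q ∈ D, H p ≤ H q) (hu : u ∈ D) : μ / 4 * ‖u - p‖ ^ 2 ≤ H u - H p := by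
  -- The midpoint of `p` and `u` suffices, hence `μ / 4` and not the sharp `μ / 2`.
  have hhalf : (0 : ℝ) ≤ 1 / 2 := by norm_num
  have h1 := hmin _ (hH.1 hp hu hhalf hhalf (by norm_num))
  have h2 := hH.2 hp hu hhalf hhalf (by norm_num)
  rw [norm_sub_rev] at h2
  simp only [smul_eq_mul] at h2
  linarith

theorem mem_argminSet_iff {m : ℕ} {F : EuclideanSpace ℝ (Fin m) → EReal} (hF : IsProperFun F)
    {p : EuclideanSpace ℝ (Fin m)} :
    p ∈ argminSet F ↔ p ∈ effDom F ∧ ∀ q ∈ effDom F, (F p).toReal ≤ (F q).toReal := by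
  constructor
  · intro h
    obtain ⟨q₀, hq₀⟩ := hF.2
    have hp : p ∈ effDom F := lt_of_le_of_lt (h q₀) hq₀
    refine ⟨hp, fun q hq => ?_⟩
    rw [← EReal.coe_le_coe_iff, hF.coe_toReal hp, hF.coe_toReal hq]
    exact h q
  · rintro ⟨hp, h⟩ q
    by_cases hq : q ∈ effDom F
    · rw [← hF.coe_toReal hp, ← hF.coe_toReal hq, EReal.coe_le_coe_iff]
      exact h q hq
    · have : F q = ⊤ := by simpa [effDom] using hq
      rw [this]; exact le_top

/-- A proper, lower semicontinuous and strongly convex function has exactly one minimizer. -/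
theorem exists_argminSet_eq_singleton {m : ℕ} {F : EuclideanSpace ℝ (Fin m) → EReal} {μ : ℝ}
    (hF : IsProperFun F) (hlsc : LowerSemicontinuous F) (hμ : 0 < μ)
    (hsc : StrongConvexOn (effDom F) μ fun x => (F x).toReal) :
    ∃ p, argminSet F = {p} := by
  obtain ⟨x₀, hx₀⟩ := hF.2
  have hball : ∀ R : ℝ, 0 ≤ R → ∃ c ∈ effDom F, ∀ q ∈ Metric.closedBall x₀ R, F c ≤ F q := by
    intro R hR
    obtain ⟨c, -, hmin⟩ := (hlsc.lowerSemicontinuousOn _).exists_isMinOn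
      ⟨x₀, Metric.mem_closedBall_self hR⟩ (isCompact_closedBall x₀ R)
    rw [isMinOn_iff] at hmin
    have hc : F c < ⊤ := (hmin x₀ (Metric.mem_closedBall_self hR)).trans_lt hx₀
    exact ⟨c, hc, hmin⟩
  obtain ⟨c, hc, hcmin⟩ := hball 1 zero_le_one
  set A := (F x₀).toReal with hA
  set B := (F c).toReal with hB
  have hBA : B ≤ A := by
    rw [← EReal.coe_le_coe_iff, hF.coe_toReal hc, hF.coe_toReal hx₀]
    exact hcmin _ (Metric.mem_closedBall_self zero_le_one)
  -- For `q` at distance `R > 1` from `x₀`, the segment point at distance 1 has value at least `B`.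
  -- Strong convexity then forces `F q ≥ F x₀` once `(R - 1) μ ≥ 2 (A - B)`, so a minimizer over the
  -- `R₀`-ball is global.
  set R₀ := 1 + 2 * (A - B) / μ with hR₀
  have hR₀1 : 1 ≤ R₀ := by
    have : 0 ≤ 2 * (A - B) / μ := div_nonneg (by linarith) hμ.le
    linarith
  obtain ⟨p, hp, hpmin⟩ := hball R₀ (by linarith)
  have hpx : F p ≤ F x₀ := hpmin _ (Metric.mem_closedBall_self (by linarith))
  have hpmem : p ∈ argminSet F := by
    rw [mem_argminSet_iff hF]
    refine ⟨hp, fun q hq => ?_⟩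
    rw [← EReal.coe_le_coe_iff, hF.coe_toReal hp, hF.coe_toReal hq]
    by_cases hqR : q ∈ Metric.closedBall x₀ R₀
    · exact hpmin q hqR
    refine hpx.trans ?_
    rw [← hF.coe_toReal hx₀, ← hF.coe_toReal hq, EReal.coe_le_coe_iff, ← hA]
    rw [Metric.mem_closedBall, not_le, dist_eq_norm] at hqR
    set R := ‖q - x₀‖ with hR
    have hR1 : 1 < R := by linarith
    have hR0 : 0 < R := by linarith
    have hinv : R⁻¹ ≤ 1 := inv_le_one_of_one_le₀ hR1.le
    have hinv0 : 0 ≤ R⁻¹ := by positivity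
    have hconv := hsc.2 hx₀ hq (by linarith : 0 ≤ 1 - R⁻¹) hinv0 (by ring)
    have hmem := hsc.1 hx₀ hq (by linarith : 0 ≤ 1 - R⁻¹) hinv0 (by ring)
    have hlow : B ≤ (F ((1 - R⁻¹) • x₀ + R⁻¹ • q)).toReal := by
      rw [← EReal.coe_le_coe_iff, hF.coe_toReal hc, hF.coe_toReal hmem]
      refine hcmin _ ?_
      have : (1 - R⁻¹) • x₀ + R⁻¹ • q - x₀ = R⁻¹ • (q - x₀) := by module
      rw [Metric.mem_closedBall, dist_eq_norm, this, norm_smul, ← hR, Real.norm_of_nonneg hinv0,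
        inv_mul_cancel₀ hR0.ne']
    rw [norm_sub_rev, ← hR] at hconv
    simp only [smul_eq_mul] at hconv
    have h1 : R * B ≤ (R - 1) * A + (F q).toReal - (R - 1) * (μ / 2 * R) := by
      have := mul_le_mul_of_nonneg_left (hlow.trans hconv) hR0.le
      rw [← hA] at this
      refine this.trans (le_of_eq ?_)
      field_simp
    have h2 : 2 * (A - B) ≤ (R - 1) * μ := by
      rw [hR₀] at hqR
      have : 2 * (A - B) / μ ≤ R - 1 := by linarith
      rwa [div_le_iff₀ hμ] at this
    nlinarith [mul_le_mul_of_nonneg_left h2 hR0.le]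
  refine ⟨p, Set.eq_singleton_iff_unique_mem.2 ⟨hpmem, fun q hq => ?_⟩⟩
  rw [mem_argminSet_iff hF] at hpmem hq
  have h1 := hsc.quadratic_growth hpmem.1 hpmem.2 hq.1
  have h2 := hq.2 p hp
  have h3 : ‖q - p‖ ^ 2 ≤ 0 := by
    by_contra! h
    nlinarith [mul_pos hμ h]
  have h4 : ‖q - p‖ = 0 := by nlinarith [norm_nonneg (q - p), sq_nonneg ‖q - p‖]
  exact sub_eq_zero.1 (norm_eq_zero.1 h4)

theorem mem_argminSet_objective_iff {m : ℕ} {f : EuclideanSpace ℝ (Fin m) → EReal}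
    (hf : IsProperFun f) {h : EuclideanSpace ℝ (Fin m) → ℝ} {p : EuclideanSpace ℝ (Fin m)} :
    p ∈ argminSet (objective f h) ↔
      p ∈ effDom f ∧ ∀ q ∈ effDom f, (f p).toReal + h p ≤ (f q).toReal + h q := by
  rw [mem_argminSet_iff (hf.objective h), effDom_objective]
  refine and_congr_right fun hp => forall₂_congr fun q hq => ?_
  rw [hf.toReal_objective h hp, hf.toReal_objective h hq]

/-- A proximal gradient step minimizes the linearized model. -/
theorem IsProx.mem_argminSet {m : ℕ} {f : EuclideanSpace ℝ (Fin m) → EReal}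
    (hf : IsProperFun f) {s : ℝ} (hs : 0 < s) {y c p : EuclideanSpace ℝ (Fin m)}
    (h : IsProx s f (y - s • c) p) :
    p ∈ argminSet (objective f fun q => inner ℝ c (q - y) + 1 / (2 * s) * ‖q - y‖ ^ 2) := by
  have key : ∀ q, 1 / (2 * s) * ‖q - (y - s • c)‖ ^ 2 =
      inner ℝ c (q - y) + 1 / (2 * s) * ‖q - y‖ ^ 2 + s / 2 * ‖c‖ ^ 2 := by
    intro q
    have hq : q - (y - s • c) = (q - y) + s • c := by abel
    rw [hq, norm_add_sq_real, inner_smul_right, real_inner_comm, norm_smul,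
      Real.norm_of_nonneg hs.le]
    field_simp
    ring
  change p ∈ argminSet (objective f fun q => 1 / (2 * s) * ‖q - (y - s • c)‖ ^ 2) at h
  rw [mem_argminSet_objective_iff hf] at h ⊢
  refine ⟨h.1, fun q hq => ?_⟩
  have := h.2 q hq
  rw [key, key] at this
  linarith

/-! ### Estimates for one inertial step -/

/-- One inertial step decreases the objective up to an inertial error. -/
theorem inertial_step_decrease {E : Type*} [NormedAddCommGroup E]
    [InnerProductSpace ℝ E] [CompleteSpace E] {g : E → ℝ} {G : E → E} {L s κ α β φp φx : ℝ}
    (hG : ∀ x, HasGradientAt g (G x) x) (hL : ∀ x y, ‖G x - G y‖ ≤ L * ‖x - y‖) (hs : 0 < s)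
    {x p d : E}
    (h : φp ≤ φx - inner ℝ (G (x + β • d)) (p - x) - κ / (2 * s) * ‖p - x‖ ^ 2 +
      α / s * inner ℝ (p - x) d) :
    φp + g p ≤ φx + g x - (κ / (2 * s) - L / 2) * ‖p - x‖ ^ 2 +
      (|α| / s + L * |β|) * (‖d‖ * ‖p - x‖) := by
  have h1 := le_quadratic_of_lipschitz_gradient hG hL x (p - x)
  rw [add_sub_cancel] at h1
  have h2 : inner ℝ (G x) (p - x) - inner ℝ (G (x + β • d)) (p - x) ≤
      L * |β| * (‖d‖ * ‖p - x‖) := by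
    rw [← inner_sub_left]
    refine (real_inner_le_norm _ _).trans ?_
    have h3 := hL x (x + β • d)
    rw [sub_add_cancel_left, norm_neg, norm_smul, Real.norm_eq_abs] at h3
    calc _ ≤ L * (|β| * ‖d‖) * ‖p - x‖ := mul_le_mul_of_nonneg_right h3 (norm_nonneg _)
      _ = _ := by ring
  have h4 : α / s * inner ℝ (p - x) d ≤ |α| / s * (‖d‖ * ‖p - x‖) := by
    rw [div_mul_eq_mul_div, div_mul_eq_mul_div]
    refine div_le_div_of_nonneg_right ?_ hs.le
    calc α * inner ℝ (p - x) d ≤ |α| * |inner ℝ (p - x) d| := by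
          rw [← abs_mul]; exact le_abs_self _
      _ ≤ |α| * (‖d‖ * ‖p - x‖) := by
          refine mul_le_mul_of_nonneg_left ?_ (abs_nonneg _)
          rw [mul_comm]; exact abs_real_inner_le_norm _ _
  linarith

/-- The error bound obtained from strong convexity and first-order optimality. -/
theorem gap_le_of_optimality {E : Type*} [NormedAddCommGroup E]
    [InnerProductSpace ℝ E] {G : E → E} {L s μ R α β r : ℝ}
    (hL : ∀ x y, ‖G x - G y‖ ≤ L * ‖x - y‖) (hL0 : 0 ≤ L) (hs : 0 < s) (hμ : 0 < μ)
    {x p d u : E} (hR : 1 ≤ R) (hα : |α| ≤ R) (hβ : |β| ≤ R)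
    (h : r + μ / 2 * ‖u - p‖ ^ 2 ≤ inner ℝ (G (x + β • d) - G p) (u - p) +
      1 / s * inner ℝ (p - (x + α • d)) (u - p)) :
    r ≤ ((L + 1 / s) * R) ^ 2 / (2 * μ) * (‖d‖ + ‖p - x‖) ^ 2 := by
  have aux : ∀ γ : ℝ, |γ| ≤ R → ‖p - (x + γ • d)‖ ≤ R * (‖d‖ + ‖p - x‖) := by
    intro γ hγ
    rw [← sub_sub]
    refine (norm_sub_le _ _).trans ?_
    rw [norm_smul, Real.norm_eq_abs]
    nlinarith [mul_le_mul_of_nonneg_right hγ (norm_nonneg d),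
      mul_le_mul_of_nonneg_right hR (norm_nonneg (p - x))]
  have h1 : inner ℝ (G (x + β • d) - G p) (u - p) ≤ L * (R * (‖d‖ + ‖p - x‖)) * ‖u - p‖ := by
    refine (real_inner_le_norm _ _).trans (mul_le_mul_of_nonneg_right ?_ (norm_nonneg _))
    refine (hL _ _).trans (mul_le_mul_of_nonneg_left ?_ hL0)
    rw [norm_sub_rev]; exact aux β hβ
  have h2 : 1 / s * inner ℝ (p - (x + α • d)) (u - p) ≤
      1 / s * (R * (‖d‖ + ‖p - x‖) * ‖u - p‖) :=
    mul_le_mul_of_nonneg_left ((real_inner_le_norm _ _).trans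
      (mul_le_mul_of_nonneg_right (aux α hα) (norm_nonneg _))) (by positivity)
  have h3 : r + μ / 2 * ‖u - p‖ ^ 2 ≤ (L + 1 / s) * R * (‖d‖ + ‖p - x‖) * ‖u - p‖ := by
    linarith
  have h4 : ((L + 1 / s) * R) ^ 2 / (2 * μ) * (‖d‖ + ‖p - x‖) ^ 2 =
      ((L + 1 / s) * R * (‖d‖ + ‖p - x‖)) ^ 2 / (2 * μ) := by ring
  rw [h4, le_div_iff₀ (by positivity)]
  generalize (L + 1 / s) * R * (‖d‖ + ‖p - x‖) = w at h3
  -- Young's inequality: `w ‖u - p‖ - (μ / 2) ‖u - p‖² ≤ w² / (2 μ)`.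
  nlinarith [sq_nonneg (w - μ * ‖u - p‖), mul_le_mul_of_nonneg_left h3 hμ.le]

theorem hasGradientAt_zero {E : Type*} [NormedAddCommGroup E] [InnerProductSpace ℝ E]
    [CompleteSpace E] (x : E) : HasGradientAt (fun _ : E => (0 : ℝ)) 0 x := by
  rw [hasGradientAt_iff_hasFDerivAt, map_zero]
  exact hasFDerivAt_const 0 x

/-- Decrease of `f` in one PADISNO step. -/
theorem IsPADISNO.decrease {m : ℕ} {f : EuclideanSpace ℝ (Fin m) → EReal}
    {g : EuclideanSpace ℝ (Fin m) → ℝ} {L : ℝ≥0} {α β : ℕ → ℝ} {a b s : ℝ}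
    {x y z : ℕ → EuclideanSpace ℝ (Fin m)} (hf : IsProperFun f)
    (h : IsPADISNO f g L α β a b s x y z) {n : ℕ} (hn : x n ∈ effDom f) :
    (f (x (n + 1))).toReal ≤ (f (x n)).toReal - inner ℝ (∇ g (z n)) (x (n + 1) - x n) -
      1 / (2 * s) * ‖x (n + 1) - x n‖ ^ 2 +
      α n / s * inner ℝ (x (n + 1) - x n) (x n - x (n - 1)) := by
  have hm := ((mem_argminSet_objective_iff hf).1 (h.step n)).2 _ hn
  have hs := h.s_pos
  rw [h.extrapolation.y_eq n] at hm
  set d := x n - x (n - 1)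
  have e1 : x (n + 1) - (x n + α n • d) = (x (n + 1) - x n) - α n • d := by abel
  have e2 : x n - (x n + α n • d) = - (α n • d) := by abel
  rw [e1, e2, norm_sub_sq_real, norm_neg, inner_sub_right, inner_neg_right,
    inner_smul_right (x (n + 1) - x n)] at hm
  have e3 : α n / s * inner ℝ (x (n + 1) - x n) d =
      1 / (2 * s) * (2 * (α n * inner ℝ (x (n + 1) - x n) d)) := by
    field_simp
  rw [e3]
  linarith

/-- Decrease of `f` in one c-PADISNO step. -/
theorem IsCPADISNO.decrease {m : ℕ} {f : EuclideanSpace ℝ (Fin m) → EReal}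
    {g : EuclideanSpace ℝ (Fin m) → ℝ} {L : ℝ≥0} {α β : ℕ → ℝ} {a b s : ℝ}
    {x y z : ℕ → EuclideanSpace ℝ (Fin m)} (hf : IsProperFun f)
    (h : IsCPADISNO f g L α β a b s x y z) {n : ℕ} (hn : x n ∈ effDom f) :
    (f (x (n + 1))).toReal ≤ (f (x n)).toReal - inner ℝ (∇ g (z n)) (x (n + 1) - x n) -
      2 / (2 * s) * ‖x (n + 1) - x n‖ ^ 2 +
      α n / s * inner ℝ (x (n + 1) - x n) (x n - x (n - 1)) := by
  have hs := h.s_pos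
  have hstep := (mem_argminSet_objective_iff hf).1 ((h.step n).mem_argminSet hf hs)
  -- With zero smooth part and modulus 0, optimality for convex `f` doubles the quadratic gain over
  -- plain comparison of model values.
  have hopt := le_of_isMinOn_proximal_model (g := fun _ => 0) (G := fun _ => 0) (L := 0)
    (fun x => hasGradientAt_zero x) (by simp) (strongConvexOn_zero.2 h.convex) hstep.1
    (by simpa only [sub_zero] using hstep.2) hn
  rw [h.extrapolation.y_eq n] at hopt
  set d := x n - x (n - 1)
  have e1 : x (n + 1) - (x n + α n • d) = (x (n + 1) - x n) - α n • d := by abel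
  have e2 : x n - x (n + 1) = -(x (n + 1) - x n) := by abel
  rw [e1, e2, sub_zero, inner_neg_right, inner_neg_right, inner_sub_left, inner_smul_left,
    real_inner_self_eq_norm_sq, real_inner_comm _ d] at hopt
  simp only [conj_trivial] at hopt
  have e3 : 2 / (2 * s) = 1 / s := by field_simp
  have e4 : α n / s * inner ℝ (x (n + 1) - x n) d =
      1 / s * (α n * inner ℝ (x (n + 1) - x n) d) := by ring
  rw [e3, e4]
  linarith

/-! ### Linear convergence -/

/-- Linear convergence of an inertial scheme whose steps minimize the linearized models and
decrease `f` with constant `κ / (2 s)`. -/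
theorem linear_convergence_of_decrease {m : ℕ} {f : EuclideanSpace ℝ (Fin m) → EReal}
    {g : EuclideanSpace ℝ (Fin m) → ℝ} {L : ℝ≥0} (hfg : ProblemSetting f g L)
    {α β : ℕ → ℝ} {a b s κ : ℝ} {x y z : ℕ → EuclideanSpace ℝ (Fin m)}
    (hα : Tendsto α atTop (𝓝 a)) (hβ : Tendsto β atTop (𝓝 b)) (hs : 0 < s)
    (hκ : s * ((L : ℝ) * (2 * |b| + 1)) < κ - 2 * |a|) (hex : Extrapolation α β x y z)
    (hstep : ∀ n, x (n + 1) ∈ argminSet (objective f fun q =>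
      inner ℝ (∇ g (z n)) (q - y n) + 1 / (2 * s) * ‖q - y n‖ ^ 2))
    (hdec : ∀ n, x n ∈ effDom f →
      (f (x (n + 1))).toReal ≤ (f (x n)).toReal - inner ℝ (∇ g (z n)) (x (n + 1) - x n) -
        κ / (2 * s) * ‖x (n + 1) - x n‖ ^ 2 +
        α n / s * inner ℝ (x (n + 1) - x n) (x n - x (n - 1)))
    (hsc : IsStronglyConvexFun (objective f g)) :
    ∃ xstar : EuclideanSpace ℝ (Fin m), argminSet (objective f g) = {xstar} ∧
      ∃ Q ∈ Set.Ico (0 : ℝ) 1, ∃ a₁ : ℝ, 0 < a₁ ∧ ∃ N : ℕ, ∀ n ≥ N,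
        objective f g (x n) - objective f g xstar ≤ ((a₁ * Q ^ n : ℝ) : EReal) ∧
        ‖x n - xstar‖ ≤ a₁ * Q ^ ((n : ℝ) / 2) ∧
        ‖y n - xstar‖ ≤ a₁ * Q ^ ((n : ℝ) / 2) ∧
        ‖z n - xstar‖ ≤ a₁ * Q ^ ((n : ℝ) / 2) := by
  obtain ⟨μ, hμ, hsc⟩ := hsc
  have hf := hfg.proper
  have hF := hf.objective g
  obtain ⟨xs, hxs⟩ := exists_argminSet_eq_singleton hF
    (lowerSemicontinuous_objective hfg.lsc hfg.diff.continuous) hμ hsc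
  refine ⟨xs, hxs, ?_⟩
  have hxsmem : xs ∈ argminSet (objective f g) := by rw [hxs]; exact Set.mem_singleton xs
  obtain ⟨hxsD, hxsmin⟩ := (mem_argminSet_iff hF).1 hxsmem
  set H : EuclideanSpace ℝ (Fin m) → ℝ := fun q => (objective f g q).toReal with hHdef
  have hHf : ∀ q ∈ effDom f, H q = (f q).toReal + g q := fun q hq => hf.toReal_objective g hq
  rw [effDom_objective] at hsc hxsD hxsmin
  have hG : ∀ q, HasGradientAt g (∇ g q) q := fun q => (hfg.diff q).hasGradientAt
  have hL : ∀ p q, ‖∇ g p - ∇ g q‖ ≤ (L : ℝ) * ‖p - q‖ := fun p q => by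
    simpa [dist_eq_norm] using hfg.lipschitz.dist_le_mul p q
  have hmodel := fun n => (mem_argminSet_objective_iff hf).1 (hstep n)
  -- `x 0` may lie outside the domain, where `toReal` of `⊤` is 0 and carries no information; every
  -- later iterate minimizes a proper model.
  have hxD : ∀ n ≥ 1, x n ∈ effDom f := by
    intro n hn
    obtain ⟨k, rfl⟩ := Nat.exists_eq_add_of_le' hn
    exact (hmodel k).1
  set R := 1 + |a| + |b| with hR
  have hR1 : 1 ≤ R := by linarith [abs_nonneg a, abs_nonneg b]
  have hαR : ∀ᶠ n in atTop, |α n| ≤ R :=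
    (hα.abs.eventually (gt_mem_nhds (by linarith [abs_nonneg b] : |a| < R))).mono fun n h => h.le
  have hβR : ∀ᶠ n in atTop, |β n| ≤ R :=
    (hβ.abs.eventually (gt_mem_nhds (by linarith [abs_nonneg a] : |b| < R))).mono fun n h => h.le
  obtain ⟨Q, ⟨hQ0, hQ1⟩, c, hc, N, hN⟩ := linear_rate_of_sufficient_decrease
    (r := fun n => H (x n) - H xs) (δ := fun n => ‖x n - x (n - 1)‖)
    (C := fun n => |α n| / s + L * |β n|) (A := κ / (2 * s) - L / 2) (c₀ := |a| / s + L * |b|)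
    (K := (((L : ℝ) + 1 / s) * R) ^ 2 / (2 * μ))
    (fun n hn => sub_nonneg.2 (hxsmin _ (hxD n hn)))
    ((hα.abs.div_const s).add (hβ.abs.const_mul (L : ℝ))) (by positivity)
    (by
      have h1 : κ / (2 * s) - L / 2 - (|a| / s + L * |b|) =
          (κ - 2 * |a| - s * (L * (2 * |b| + 1))) / (2 * s) := by field_simp; ring
      have h2 : 0 < (κ - 2 * |a| - s * (L * (2 * |b| + 1))) / (2 * s) :=
        div_pos (by linarith) (by linarith)
      linarith)
    (fun n => norm_nonneg _) (by positivity)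
    (by
      intro n hn
      have h1 := hdec n (hxD n hn)
      rw [hex.z_eq n] at h1
      have h2 := inertial_step_decrease hG hL hs h1
      simp only [Nat.add_sub_cancel, hHf _ (hxD n hn), hHf _ (hmodel n).1]
      linarith)
    (by
      filter_upwards [hαR, hβR] with n h1 h2
      have h3 := le_of_isMinOn_proximal_model (s := s) (y := y n) (c := ∇ g (z n)) hG hL hsc
        (hmodel n).1 (fun q hq => by
          have := (hmodel n).2 q hq
          change H _ - _ + _ ≤ H _ - _ + _
          rw [hHf _ hq, hHf _ (hmodel n).1]
          linarith) hxsD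
      change H _ + _ ≤ H _ + _ + _ at h3
      rw [hex.z_eq n, hex.y_eq n] at h3
      simp only [Nat.add_sub_cancel]
      exact gap_le_of_optimality (u := xs) hL L.2 hs hμ hR1 h1 h2 (by linarith))
  obtain ⟨N', hN'⟩ := eventually_atTop.1 ((hαR.and hβR).and (eventually_ge_atTop 1))
  have hsq : ∀ n : ℕ, Q ^ ((n : ℝ) / 2) = √(Q ^ n) := fun n => by
    rw [Real.sqrt_eq_rpow, ← Real.rpow_natCast, ← Real.rpow_mul hQ0.le]
    congr 1; ring
  -- The summands cover the gap, the distance `‖x n - xs‖`, and the extrapolation term.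
  refine ⟨Q, ⟨hQ0.le, hQ1⟩, c + (√(4 / μ * c) + R * √c), by positivity, max N N', fun n hn => ?_⟩
  obtain ⟨⟨hαn, hβn⟩, hn1⟩ := hN' n (le_of_max_le_right hn)
  obtain ⟨hr, hδ⟩ := hN n (le_of_max_le_left hn)
  have hxn := hxD n hn1
  have hQn : 0 ≤ Q ^ n := by positivity
  have hx : ‖x n - xs‖ ≤ √(4 / μ * c) * √(Q ^ n) := by
    rw [← Real.sqrt_mul (by positivity)]
    refine Real.le_sqrt_of_sq_le ?_
    have h1 := hsc.quadratic_growth hxsD hxsmin hxn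
    have h2 : μ / 4 * ‖x n - xs‖ ^ 2 ≤ c * Q ^ n := h1.trans hr
    have h3 : 4 / μ * (μ / 4 * ‖x n - xs‖ ^ 2) ≤ 4 / μ * (c * Q ^ n) :=
      mul_le_mul_of_nonneg_left h2 (by positivity)
    have h4 : 4 / μ * (μ / 4 * ‖x n - xs‖ ^ 2) = ‖x n - xs‖ ^ 2 := by field_simp
    linarith
  have hd : ‖x n - x (n - 1)‖ ≤ √c * √(Q ^ n) := by
    rw [← Real.sqrt_mul hc.le]
    exact Real.le_sqrt_of_sq_le hδ
  have hext : ∀ γ : ℝ, |γ| ≤ R → ‖x n + γ • (x n - x (n - 1)) - xs‖ ≤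
      (c + (√(4 / μ * c) + R * √c)) * √(Q ^ n) := by
    intro γ hγ
    have h1 : x n + γ • (x n - x (n - 1)) - xs = (x n - xs) + γ • (x n - x (n - 1)) := by abel
    rw [h1]
    refine (norm_add_le _ _).trans ?_
    rw [norm_smul, Real.norm_eq_abs]
    have h2 : |γ| * ‖x n - x (n - 1)‖ ≤ R * (√c * √(Q ^ n)) :=
      mul_le_mul hγ hd (norm_nonneg _) (by linarith)
    have h3 : 0 ≤ c * √(Q ^ n) := by positivity
    linarith
  rw [hsq, hex.y_eq n, hex.z_eq n]
  refine ⟨?_, ?_, hext _ hαn, hext _ hβn⟩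
  · have hxF : x n ∈ effDom (objective f g) := by rwa [effDom_objective]
    have hxsF : xs ∈ effDom (objective f g) := by rwa [effDom_objective]
    rw [← hF.coe_toReal hxF, ← hF.coe_toReal hxsF, ← EReal.coe_sub, EReal.coe_le_coe_iff]
    have h1 : 0 ≤ (√(4 / μ * c) + R * √c) * Q ^ n := by positivity
    have h2 : H (x n) - H xs ≤ c * Q ^ n := hr
    change H (x n) - H xs ≤ _
    linarith
  · simpa using hext 0 (by simpa using zero_le_one.trans hR1)

theorem theorem5p1 {m : ℕ} (f : EuclideanSpace ℝ (Fin m) → EReal)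
    (g : EuclideanSpace ℝ (Fin m) → ℝ) (L : ℝ≥0) (hfg : ProblemSetting f g L)
    (α β : ℕ → ℝ) (a b s : ℝ) (x y z : ℕ → EuclideanSpace ℝ (Fin m))
    (hgen : IsPADISNO f g L α β a b s x y z ∨ IsCPADISNO f g L α β a b s x y z)
    (hsc : IsStronglyConvexFun (objective f g)) :
    ∃ xstar : EuclideanSpace ℝ (Fin m), argminSet (objective f g) = {xstar} ∧
      ∃ Q ∈ Set.Ico (0 : ℝ) 1, ∃ a₁ : ℝ, 0 < a₁ ∧ ∃ N : ℕ, ∀ n ≥ N,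
        objective f g (x n) - objective f g xstar ≤ ((a₁ * Q ^ n : ℝ) : EReal) ∧
        ‖x n - xstar‖ ≤ a₁ * Q ^ ((n : ℝ) / 2) ∧
        ‖y n - xstar‖ ≤ a₁ * Q ^ ((n : ℝ) / 2) ∧
        ‖z n - xstar‖ ≤ a₁ * Q ^ ((n : ℝ) / 2) := by
  rcases hgen with h | h
  · exact linear_convergence_of_decrease hfg h.α_lim h.β_lim h.s_pos h.s_lt h.extrapolation
      h.step (fun n hn => h.decrease hfg.proper hn) hsc
  · exact linear_convergence_of_decrease (κ := 2) hfg h.α_lim h.β_lim h.s_pos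
      (by linarith [h.s_lt]) h.extrapolation
      (fun n => (h.step n).mem_argminSet hfg.proper h.s_pos)
      (fun n hn => h.decrease hfg.proper hn) hsc
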